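/- **Definitions.** A partial multivalued mapping $f:\subseteq X\rightrightarrows Y$ assigns to each $x\in X$ a set $f(x)\subseteq Y$; $\operatorname{dom}(f)=\{x: f(x)\neq\emptyset\}$. For topological spaces $X,Y$ and $D\subseteq\operatorname{dom}(f)$, $f|_D$ is *continuous* if for every $x\in D$ there is $y\in f(x)$ such that for every open $V\ni y$ there is a neighbourhood $U$ of $x$ with $f(z)\cap V\neq\emptyset$ for all $z\in U\cap D$. The *cardinal of discontinuity* $\mathfrak C_{\rm t}(f)$ is the least cardinality of a covering $\Delta$ of $\operatorname{dom}(f)$ such that $f|_D$ is continuous for each $D\in\Delta$. For representations $\alpha$ of $X$ and $\beta$ of $Y$ (partial surjections from infinite sequences), the *complexity of nonuniform $(\alpha,\beta)$-computability* $\mathfrak C_{\rm c}(f,\alpha,\beta)$ is the least cardinality of an at most countable partition $\Delta$ of $\operatorname{dom}(f)$ for which there are a notation $\delta$ of $\Delta$ (a partial surjection from finite strings, i.e. natural numbers, onto $\Delta$) and a Type-2 machine that, given any $\alpha$-name of any $a\in\operatorname{dom}(f)$ and any $\delta$-name of the $D\in\Delta$ with $a\in D$, outputs a $\beta$-name of some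 $y\in f(a)$. The representation $\rho$ of $\mathbb R$ names $x$ by (codes of) rational sequences $(q_t)_{t\in\mathbb N}$ with $|x-q_t|\le 2^{-t}$; $\rho^{m}$ and $\rho^{n\times m}$ are the induced entrywise representations of $\mathbb R^m$ and $\mathbb R^{n\times m}$. A *witness of discontinuity* of $f$ at $x\in\operatorname{dom}(f)$ is a sequence $(x_m)$ in $\operatorname{dom}(f)$ converging to $x$ such that every $y\in f(x)$ has an open neighbourhood $V$ with $f(x_m)\cap V=\emptyset$ for infinitely many $m$. A *witness of $d$-discontinuity* of $f$ is a family $(x_{\bar n})$ in $\operatorname{dom}(f)$, indexed by the multi-indices $\bar n\in\mathbb N^k$, $0\le k\le d$, such that for all $0\le k<d$, $\bar n\in\mathbb N^k$ and $1\le \ell\le d-k$ the sequence $\big(x_{\bar n,m,\ldots,m}\big)_{m}$ (with $m$ repeated $\ell$ times) is a witness of discontinuity of $f$ at $x_{\bar n}$ (in particular it converges to $x_{\bar n}$). **Theorem.** Let $n,m\in\mathbb N$ with $m\ge 1$, let $d:=\min(n,m-1)$, and consider the multivalued mapping on $\mathbb R^{n\times m}$ $$\operatorname{LinEq}_{n,m}: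 A\;\mapsto\;\operatorname{kernel}(A)\setminus\{0\}\subseteq\mathbb R^m .$$ Then: 1. $\operatorname{LinEq}_{n,m}(A)\neq\emptyset$ if and only if $\operatorname{rank}(A)\le d$, i.e. $\operatorname{dom}(\operatorname{LinEq}_{n,m})=\{A\in\mathbb R^{n\times m}:\operatorname{rank}(A)\le d\}$. 2. $\mathfrak C_{\rm t}(\operatorname{LinEq}_{n,m})=\mathfrak C_{\rm c}(\operatorname{LinEq}_{n,m},\rho^{n\times m},\rho^m)=d+1$. 3. Knowing the rank suffices: there is a Type-2 machine that, given any $\rho^{n\times m}$-name of any $A$ with $\operatorname{rank}(A)\le d$ together with the integer $\operatorname{rank}(A)$, outputs a $\rho^m$-name of some element of $\operatorname{LinEq}_{n,m}(A)$. 4. $\operatorname{LinEq}_{n,m}$ admits a witness of $d$-discontinuity. -/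

import Mathlib

open Filter Topology Cardinal

universe u v

/-! ### Multivalued mappings and their cardinal of discontinuity

A partial multivalued mapping from `X` to `Y` is a function `X → Set Y`;
it is defined at the points where its value is nonempty. -/

/-- The domain of a multivalued mapping. -/
def MultiDom {X Y : Type*} (f : X → Set Y) : Set X := {x | (f x).Nonempty}

/-- The restriction of the multivalued mapping `f` to the subspace `D` is continuous:
at every `x ∈ D` there is some `y ∈ f x` such that for every open `V ∋ y` there is
a neighbourhood `U` of `x` with `f z ∩ V ≠ ∅` for all `z ∈ U ∩ D`. -/
def MultiContinuousOn {X Y : Type*} [TopologicalSpace X] [TopologicalSpace Y]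
    (f : X → Set Y) (D : Set X) : Prop :=
  ∀ x ∈ D, ∃ y ∈ f x, ∀ V : Set Y, IsOpen V → y ∈ V →
    ∃ U ∈ 𝓝 x, ∀ z ∈ U ∩ D, (f z ∩ V).Nonempty

/-- `f` is `k`-continuous: its domain has a covering by `k` sets
on each of which `f` is continuous. -/
def IsKContinuous {X : Type u} {Y : Type v} [TopologicalSpace X] [TopologicalSpace Y]
    (f : X → Set Y) (k : Cardinal.{u}) : Prop :=
  ∃ Δ : Set (Set X), ⋃₀ Δ = MultiDom f ∧ #Δ = k ∧ ∀ D ∈ Δ, MultiContinuousOn f D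

/-- The cardinal of discontinuity of `f` (the least `k` such that `f` is `k`-continuous)
is `k`. -/
def IsCardinalOfDiscontinuity {X : Type u} {Y : Type v} [TopologicalSpace X]
    [TopologicalSpace Y] (f : X → Set Y) (k : Cardinal.{u}) : Prop :=
  IsLeast {k | IsKContinuous f k} k

/-! ### Type-2 computability -/

/-- A Type-2 (monotone) machine with a discrete input `w : ℕ` and an infinite input
`p : ℕ → ℕ`. `run w σ` is what has been written on the one-way output tape on discrete
input `w` when the finite initial segment `σ` of the infinite input has been processed. -/
structure Type2Machine where
  run : ℕ → List ℕ → List ℕ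
  computable : Computable₂ run
  monotone : ∀ (w : ℕ) (σ τ : List ℕ), σ <+: τ → run w σ <+: run w τ

/-- On inputs `w` and `p`, the machine `M` writes the infinite sequence `q`. -/
def Type2Machine.Outputs (M : Type2Machine) (w : ℕ) (p q : ℕ → ℕ) : Prop :=
  ∀ i : ℕ, ∃ N : ℕ, (M.run w ((List.range N).map p))[i]? = some (q i)

/-- A representation of `X`: a partial surjection from infinite sequences onto `X`,
given by its graph. -/
structure TTERepresentation (X : Type u) where
  IsName : (ℕ → ℕ) → X → Prop
  unique : ∀ p x y, IsName p x → IsName p y → x = y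
  surjective : ∀ x, ∃ p, IsName p x

/-- A notation of a (necessarily countable) set `S`: a partial surjection from finite
objects, coded as natural numbers, onto `S`, given by its graph. -/
structure TTENumbering (S : Type u) where
  IsName : ℕ → S → Prop
  unique : ∀ w x y, IsName w x → IsName w y → x = y
  surjective : ∀ x, ∃ w, IsName w x

/-- The multivalued mapping `f` is `(α, β)`-computable with `k`-wise advice: there are
an at most countable partition `Δ` of its domain with `k` members, a notation `δ` of `Δ`,
and a machine that, given an `α`-name of any `a` in the domain and a `δ`-name of the
member of `Δ` containing `a`, outputs a `β`-name of some element of `f a`. -/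
def IsComputableWithAdvice {X : Type u} {Y : Type v} (α : TTERepresentation X)
    (β : TTERepresentation Y) (f : X → Set Y) (k : Cardinal.{u}) : Prop :=
  ∃ Δ : Set (Set X), ∅ ∉ Δ ∧ Δ.PairwiseDisjoint id ∧ ⋃₀ Δ = MultiDom f ∧ Δ.Countable ∧
    #Δ = k ∧ ∃ (δ : TTENumbering Δ) (M : Type2Machine),
      ∀ (D : Δ), ∀ a ∈ (D : Set X), ∀ p, α.IsName p a → ∀ w, δ.IsName w D →
        ∃ q, M.Outputs w p q ∧ ∃ y ∈ f a, β.IsName q y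

/-- The complexity of nonuniform `(α, β)`-computability of `f` (the least `k` such that `f`
is `(α, β)`-computable with `k`-wise advice) is `k`. -/
def IsNonuniformComplexity {X : Type u} {Y : Type v} (α : TTERepresentation X)
    (β : TTERepresentation Y) (f : X → Set Y) (k : Cardinal.{u}) : Prop :=
  IsLeast {k | IsComputableWithAdvice α β f k} k

/-- Knowing the integer `g a` suffices for computing `f`: some machine, given an
`α`-name of any `a` in the domain and the value `g a`, outputs a `β`-name of some
element of `f a`. -/
def IsComputableKnowing {X : Type u} {Y : Type v} (α : TTERepresentation X)
    (β : TTERepresentation Y) (f : X → Set Y) (g : X → ℕ) : Prop :=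
  ∃ M : Type2Machine, ∀ a ∈ MultiDom f, ∀ p, α.IsName p a →
    ∃ q, M.Outputs (g a) p q ∧ ∃ y ∈ f a, β.IsName q y

/-- The standard notation of the rationals: the code of `((a, b), c)` denotes
`(a - b) / (c + 1)`. -/
def ratOfCode (c : ℕ) : ℚ :=
  ((c.unpair.1.unpair.1 : ℚ) - (c.unpair.1.unpair.2 : ℚ)) / ((c.unpair.2 : ℚ) + 1)

theorem ratOfCode_surjective : Function.Surjective ratOfCode := by
  intro q
  refine ⟨Nat.pair (Nat.pair q.num.toNat (-q.num).toNat) (q.den - 1), ?_⟩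
  have hd : (((q.den - 1 : ℕ) : ℚ) + 1) = q.den := by
    have := q.den_pos
    exact_mod_cast Nat.sub_add_cancel this
  have hn : ((q.num.toNat : ℚ) - ((-q.num).toNat : ℚ)) = q.num := by
    exact_mod_cast Int.toNat_sub_toNat_neg q.num
  simp only [ratOfCode, Nat.unpair_pair, hd, hn]
  exact Rat.num_div_den q

/-- The Cauchy representation `ρ` of the reals: a name of `x` is a sequence of (codes of)
rationals `q_t` with `|x - q_t| ≤ 2^{-t}`. -/
def rho : TTERepresentation ℝ where
  IsName p x := ∀ t : ℕ, |x - (ratOfCode (p t) : ℝ)| ≤ 1 / 2 ^ t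
  unique p x y hx hy := by
    refine eq_of_abs_sub_nonpos (le_of_forall_pos_le_add fun ε hε => ?_)
    obtain ⟨t, ht⟩ := exists_pow_lt_of_lt_one (half_pos hε) (by norm_num : (1 / 2 : ℝ) < 1)
    rw [one_div_pow] at ht
    have h1 := hx t
    have h2 := hy t
    rw [abs_le] at *
    constructor <;> linarith [h1.1, h1.2, h2.1, h2.2]
  surjective x := by
    have h : ∀ t : ℕ, ∃ c : ℕ, |x - (ratOfCode c : ℝ)| ≤ 1 / 2 ^ t := fun t => by
      obtain ⟨q, hq⟩ := exists_rat_near x (by positivity : (0 : ℝ) < 1 / 2 ^ t)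
      obtain ⟨c, rfl⟩ := ratOfCode_surjective q
      exact ⟨c, hq.le⟩
    choose p hp using h
    exact ⟨p, hp⟩

/-- The `k`-fold product representation: a name of `(x_0, …, x_{k-1})` is the
interleaving of names of the `x_i`. -/
def TTERepresentation.pow {X : Type u} (α : TTERepresentation X) (k : ℕ) :
    TTERepresentation (Fin k → X) where
  IsName p x := ∀ i : Fin k, α.IsName (fun t => p (k * t + i)) (x i)
  unique p x y hx hy := funext fun i => α.unique _ _ _ (hx i) (hy i)
  surjective x := by
    choose q hq using fun i => α.surjective (x i)
    refine ⟨fun s => if h : 0 < k then q ⟨s % k, Nat.mod_lt s h⟩ (s / k) else 0, fun i => ?_⟩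
    have hk : 0 < k := i.pos
    convert hq i using 2 with t
    simp [hk, Nat.mod_eq_of_lt i.isLt, Nat.mul_add_div hk,
      Nat.div_eq_of_lt i.isLt]

/-- The representation of real `n × m` matrices through `ρ`-names of their entries. -/
def rhoMatrix (n m : ℕ) : TTERepresentation (Matrix (Fin n) (Fin m) ℝ) := (rho.pow m).pow n

/-! ### Witnesses of discontinuity -/

/-- A uniform `d`-dimensional flag: points `x n̄` for the multi-indices `n̄` of length at most
`d` with `x n̄ = lim_m x (n̄, m, …, m)` for every number `1 ≤ l ≤ d - |n̄|` of repetitions of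
`m` (the case `l = 1` being the condition on an arbitrary flag). -/
def IsUniformFlag {X : Type*} [TopologicalSpace X] (d : ℕ) (x : List ℕ → X) : Prop :=
  ∀ (ν : List ℕ) (l : ℕ), 1 ≤ l → ν.length + l ≤ d →
    Tendsto (fun m => x (ν ++ List.replicate l m)) atTop (𝓝 (x ν))

/-- `s` is a witness of discontinuity of `f` at `x`. -/
def IsDiscontinuityWitness {X Y : Type*} [TopologicalSpace X] [TopologicalSpace Y]
    (f : X → Set Y) (x : X) (s : ℕ → X) : Prop :=
  x ∈ MultiDom f ∧ (∀ m, s m ∈ MultiDom f) ∧ Tendsto s atTop (𝓝 x) ∧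
    ∀ y ∈ f x, ∃ V : Set Y, IsOpen V ∧ y ∈ V ∧ ∃ᶠ m in atTop, Disjoint (f (s m)) V

/-- The flag `x` is a witness of `d`-discontinuity of `f`. -/
def IsKDiscontinuityWitness {X Y : Type*} [TopologicalSpace X] [TopologicalSpace Y]
    (f : X → Set Y) (d : ℕ) (x : List ℕ → X) : Prop :=
  (∀ ν : List ℕ, ν.length ≤ d → x ν ∈ MultiDom f) ∧ IsUniformFlag d x ∧
    ∀ (ν : List ℕ) (l : ℕ), 1 ≤ l → ν.length + l ≤ d →
      IsDiscontinuityWitness f (x ν) (fun m => x (ν ++ List.replicate l m))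

/-! ### Solving homogeneous linear equations -/

/-- The multivalued mapping sending a matrix to the nonzero vectors in its kernel. -/
def LinEq (n m : ℕ) (A : Matrix (Fin n) (Fin m) ℝ) : Set (Fin m → ℝ) :=
  (LinearMap.ker A.mulVecLin : Set (Fin m → ℝ)) \ {0}

/-! Upper bounds: if `A` has rank `r`, a nonzero `r × r` minor selects rows spanning the row space,
and Cramer's rule turns it into a kernel vector polynomial in the entries of `A`
(`cramerVector_mem_linEq`). Nonvanishing of a minor is confirmed by sufficiently good
approximations, so a machine that knows the rank searches for such a minor and then commits to it
(`isComputableKnowing_rank`). The `d + 1` rank strata thus serve as advice. A machine is continuous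
in its input (`multiContinuousOn_of_machine`), so they also form a cover by sets of continuity.

Lower bounds: let `D` be a set of continuity containing `A`, of rank less than `n`, with `y` the
limit value at `A`. For `u` outside the range of `A`, the matrix `A + ε u yᵀ` has rank one more and
kills no vector near `y`, and this persists nearby; for small `ε` a whole neighbourhood of it
therefore misses `D` (`exists_rank_succ_eventually_notMem`). Starting from the zero matrix, `d` such
steps end at a matrix of rank `d` near which `d` members of the cover are absent. It lies in the
domain, so a further member must contain it.

The flag of discontinuities is explicit: its rows are shrinking multiples of basis vectors, and a
suitable new row forces any prescribed coordinate of a solution to vanish. -/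

theorem mem_LinEq {n m : ℕ} {A : Matrix (Fin n) (Fin m) ℝ} {y : Fin m → ℝ} :
    y ∈ LinEq n m A ↔ A.mulVec y = 0 ∧ y ≠ 0 := by
  simp [LinEq]

/-! ### Rank, kernel and rank-one perturbations. -/

theorem rank_add_finrank_ker_mulVecLin {n m : ℕ} (A : Matrix (Fin n) (Fin m) ℝ) :
    A.rank + Module.finrank ℝ (LinearMap.ker A.mulVecLin) = m := by
  have h := A.mulVecLin.finrank_range_add_finrank_ker
  rwa [Module.finrank_fin_fun] at h

theorem linEq_nonempty_iff {n m : ℕ} (A : Matrix (Fin n) (Fin m) ℝ) :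
    (LinEq n m A).Nonempty ↔ A.rank < m := by
  have h := rank_add_finrank_ker_mulVecLin A
  have h2 : (LinEq n m A).Nonempty ↔ LinearMap.ker A.mulVecLin ≠ ⊥ := by
    rw [Submodule.ne_bot_iff]
    constructor
    · rintro ⟨y, hy⟩
      exact ⟨y, hy.1, hy.2⟩
    · rintro ⟨y, hy, h0⟩
      exact ⟨y, hy, h0⟩
  rw [h2, ← Submodule.one_le_finrank_iff]
  omega

theorem multiDom_linEq (n m d : ℕ) (hm : 1 ≤ m) (hd : d = min n (m - 1)) :
    MultiDom (LinEq n m) = {A : Matrix (Fin n) (Fin m) ℝ | A.rank ≤ d} := by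
  ext A
  have := A.rank_le_height
  simp only [MultiDom, Set.mem_ofPred_eq, linEq_nonempty_iff]
  omega

theorem exists_notMem_range_mulVecLin {n m : ℕ} {A : Matrix (Fin n) (Fin m) ℝ}
    (h : A.rank < n) : ∃ u, u ∉ LinearMap.range A.mulVecLin := by
  by_contra! H
  have : LinearMap.range A.mulVecLin = ⊤ := eq_top_iff.2 fun u _ => H u
  rw [Matrix.rank, this, finrank_top, Module.finrank_fin_fun] at h
  exact lt_irrefl _ h

theorem rank_add_le {n m : ℕ} (A B : Matrix (Fin n) (Fin m) ℝ) :
    (A + B).rank ≤ A.rank + B.rank := by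
  have h : LinearMap.range (A + B).mulVecLin ≤
      LinearMap.range A.mulVecLin ⊔ LinearMap.range B.mulVecLin := by
    rintro _ ⟨v, rfl⟩
    rw [Matrix.mulVecLin_add, LinearMap.add_apply]
    exact Submodule.add_mem_sup ⟨v, rfl⟩ ⟨v, rfl⟩
  exact (Submodule.finrank_mono h).trans (Submodule.finrank_add_le_finrank_add_finrank _ _)

/-- The rank-one perturbation of `A` in direction `u yᵀ`. -/
def rankOnePerturb {n m : ℕ} (A : Matrix (Fin n) (Fin m) ℝ) (u : Fin n → ℝ) (y : Fin m → ℝ)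
    (ε : ℝ) : Matrix (Fin n) (Fin m) ℝ :=
  A + ε • Matrix.vecMulVec u y

theorem rankOnePerturb_mulVec {n m : ℕ} (A : Matrix (Fin n) (Fin m) ℝ) (u : Fin n → ℝ)
    (y v : Fin m → ℝ) (ε : ℝ) :
    (rankOnePerturb A u y ε).mulVec v = A.mulVec v + (ε * (y ⬝ᵥ v)) • u := by
  rw [rankOnePerturb, Matrix.add_mulVec, Matrix.smul_mulVec, Matrix.vecMulVec_mulVec]
  ext i
  simp
  ring

theorem tendsto_rankOnePerturb {n m : ℕ} (A : Matrix (Fin n) (Fin m) ℝ) (u : Fin n → ℝ)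
    (y : Fin m → ℝ) : Tendsto (rankOnePerturb A u y) (𝓝[>] 0) (𝓝 A) := by
  have h : Continuous (rankOnePerturb A u y) := by
    unfold rankOnePerturb
    fun_prop
  have h0 : rankOnePerturb A u y 0 = A := by simp [rankOnePerturb]
  have h1 := h.tendsto 0
  rw [h0] at h1
  exact h1.mono_left nhdsWithin_le_nhds

/-- Otherwise `A v = -ε (y ⬝ᵥ v) u` with a nonzero factor, which puts `u` in the range of `A`. -/
theorem rankOnePerturb_mulVec_ne_zero {n m : ℕ} {A : Matrix (Fin n) (Fin m) ℝ} {u : Fin n → ℝ}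
    (hu : u ∉ LinearMap.range A.mulVecLin) {y v : Fin m → ℝ} {ε : ℝ} (hε : 0 < ε)
    (hv : 0 < y ⬝ᵥ v) : (rankOnePerturb A u y ε).mulVec v ≠ 0 := by
  rw [rankOnePerturb_mulVec]
  intro h
  have hc : ε * (y ⬝ᵥ v) ≠ 0 := by positivity
  refine hu ⟨-(ε * (y ⬝ᵥ v))⁻¹ • v, ?_⟩
  rw [Matrix.mulVecLin_apply, Matrix.mulVec_smul, eq_neg_of_add_eq_zero_left h, neg_smul,
    smul_neg, neg_neg, smul_smul, inv_mul_cancel₀ hc, one_smul]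

/-- The kernel strictly shrinks: whatever the perturbed matrix kills is orthogonal to `y`, hence
killed by `A`, while `y` itself is no longer killed. A rank-one term adds at most one. -/
theorem rank_rankOnePerturb {n m : ℕ} {A : Matrix (Fin n) (Fin m) ℝ} {u : Fin n → ℝ}
    (hu : u ∉ LinearMap.range A.mulVecLin) {y : Fin m → ℝ} (hy : y ∈ LinEq n m A)
    {ε : ℝ} (hε : 0 < ε) : (rankOnePerturb A u y ε).rank = A.rank + 1 := by
  rw [mem_LinEq] at hy
  have hyy : 0 < y ⬝ᵥ y := by
    simpa using Matrix.dotProduct_star_self_pos_iff.2 hy.2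
  have hB := rankOnePerturb_mulVec_ne_zero hu hε hyy
  have hle : (rankOnePerturb A u y ε).rank ≤ A.rank + 1 := by
    refine (rank_add_le _ _).trans (Nat.add_le_add_left ?_ _)
    rw [← Matrix.smul_vecMulVec]
    exact Matrix.rank_vecMulVec_le _ _
  have hlt : LinearMap.ker (rankOnePerturb A u y ε).mulVecLin < LinearMap.ker A.mulVecLin := by
    refine lt_of_le_of_ne (fun v hv => ?_) fun h => hB ?_
    · rw [LinearMap.mem_ker, Matrix.mulVecLin_apply] at hv ⊢
      by_cases h0 : y ⬝ᵥ v = 0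
      · simpa [rankOnePerturb_mulVec, h0] using hv
      · rcases lt_or_gt_of_ne h0 with h0 | h0
        · have h1 : 0 < y ⬝ᵥ (-v) := by simpa using h0
          refine absurd ?_ (rankOnePerturb_mulVec_ne_zero hu hε h1)
          rw [Matrix.mulVec_neg, hv, neg_zero]
        · exact absurd hv (rankOnePerturb_mulVec_ne_zero hu hε h0)
    · have : y ∈ LinearMap.ker A.mulVecLin := hy.1
      rwa [← h] at this
  have hlt := Submodule.finrank_lt_finrank_of_lt hlt
  have h1 := rank_add_finrank_ker_mulVecLin A
  have h2 := rank_add_finrank_ker_mulVecLin (rankOnePerturb A u y ε)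
  omega

/-! ### Lower bound on the size of a cover. -/

/-- Every set on which `LinEq` is continuous is avoided by a neighbourhood of some matrix of
rank `k + 1` near a given matrix of rank `k` in that set. -/
theorem exists_rank_succ_eventually_notMem {n m : ℕ} {A : Matrix (Fin n) (Fin m) ℝ}
    (hn : A.rank < n) {D : Set (Matrix (Fin n) (Fin m) ℝ)} (hA : A ∈ D)
    (hD : MultiContinuousOn (LinEq n m) D) {P : Matrix (Fin n) (Fin m) ℝ → Prop}
    (hP : ∀ᶠ C in 𝓝 A, P C) :
    ∃ B : Matrix (Fin n) (Fin m) ℝ, B.rank = A.rank + 1 ∧ ∀ᶠ C in 𝓝 B, P C ∧ C ∉ D := by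
  obtain ⟨y, hy, hcont⟩ := hD A hA
  obtain ⟨u, hu⟩ := exists_notMem_range_mulVecLin hn
  have hyy : 0 < y ⬝ᵥ y := by
    simpa using Matrix.dotProduct_star_self_pos_iff.2 hy.2
  have hopen : IsOpen {v : Fin m → ℝ | 0 < y ⬝ᵥ v} :=
    isOpen_lt continuous_const (by fun_prop)
  -- Compactness of `K` makes nonvanishing on all of `K` an open condition on the matrix.
  obtain ⟨K, hK, hyK, hKsub⟩ := exists_compact_subset hopen (show y ∈ _ from hyy)
  obtain ⟨U, hU, hUD⟩ := hcont (interior K) isOpen_interior hyK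
  have h1 : ∀ᶠ C in 𝓝 A, ∀ᶠ C' in 𝓝 C, P C' ∧ C' ∈ U :=
    eventually_eventually_nhds.2 (hP.and hU)
  obtain ⟨ε, hε, hε0⟩ := (((tendsto_rankOnePerturb A u y).eventually h1).and
    self_mem_nhdsWithin).exists
  refine ⟨_, rank_rankOnePerturb hu hy hε0, ?_⟩
  have h2 : ∀ᶠ C in 𝓝 (rankOnePerturb A u y ε), ∀ v ∈ K, C.mulVec v ≠ 0 := by
    refine hK.eventually_forall_of_forall_eventually fun v hv => ?_
    have hc : Continuous fun z : Matrix (Fin n) (Fin m) ℝ × (Fin m → ℝ) => z.1.mulVec z.2 :=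
      continuous_fst.matrix_mulVec continuous_snd
    exact hc.continuousAt.eventually_ne (rankOnePerturb_mulVec_ne_zero hu hε0 (hKsub hv))
  filter_upwards [hε, h2] with C hC hCK
  refine ⟨hC.1, fun hCD => ?_⟩
  obtain ⟨v, hv, hvK⟩ := hUD C ⟨hC.2, hCD⟩
  exact hCK v (interior_subset hvK) hv.1

/-- Each step adds to `S` a member `D` containing the current matrix. It is new, since the members
already in `S` miss a neighbourhood of that matrix. -/
theorem exists_rank_eventually_notMem {n m : ℕ} (hm : 1 ≤ m)
    {Δ : Set (Set (Matrix (Fin n) (Fin m) ℝ))} (hΔ : ⋃₀ Δ = MultiDom (LinEq n m))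
    (hc : ∀ D ∈ Δ, MultiContinuousOn (LinEq n m) D) (k : ℕ) (hk : k ≤ min n (m - 1)) :
    ∃ A : Matrix (Fin n) (Fin m) ℝ, A.rank = k ∧
      ∃ S : Finset (Set (Matrix (Fin n) (Fin m) ℝ)), (S : Set _) ⊆ Δ ∧ S.card = k ∧
        ∀ᶠ C in 𝓝 A, ∀ D ∈ S, C ∉ D := by
  classical
  induction k with
  | zero => exact ⟨0, Matrix.rank_zero, ∅, by simp, rfl, by simp⟩
  | succ k ih =>
    obtain ⟨A, hA, S, hS, hcard, hev⟩ := ih (by omega)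
    have hdom : A ∈ ⋃₀ Δ := by
      rw [hΔ]
      exact (linEq_nonempty_iff A).2 (by omega)
    obtain ⟨D, hD, hAD⟩ := hdom
    obtain ⟨B, hB, hBev⟩ := exists_rank_succ_eventually_notMem (by omega) hAD (hc D hD) hev
    refine ⟨B, by omega, insert D S, ?_, ?_, ?_⟩
    · rw [Finset.coe_insert]
      exact Set.insert_subset hD hS
    · rw [Finset.card_insert_of_notMem fun h => hev.self_of_nhds D h hAD, hcard]
    · filter_upwards [hBev] with C hC
      simpa using ⟨hC.2, hC.1⟩

theorem le_mk_of_multiContinuousOn_linEq {n m d : ℕ} (hm : 1 ≤ m) (hd : d = min n (m - 1))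
    {Δ : Set (Set (Matrix (Fin n) (Fin m) ℝ))} (hΔ : ⋃₀ Δ = MultiDom (LinEq n m))
    (hc : ∀ D ∈ Δ, MultiContinuousOn (LinEq n m) D) : (d : Cardinal) + 1 ≤ #Δ := by
  classical
  obtain ⟨A, hA, S, hS, hcard, hev⟩ := exists_rank_eventually_notMem hm hΔ hc d hd.le
  have hdom : A ∈ ⋃₀ Δ := by
    rw [hΔ]
    exact (linEq_nonempty_iff A).2 (by omega)
  obtain ⟨D, hD, hAD⟩ := hdom
  have hsub : ((insert D S : Finset _) : Set (Set (Matrix (Fin n) (Fin m) ℝ))) ⊆ Δ := by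
    rw [Finset.coe_insert]
    exact Set.insert_subset hD hS
  have h : #(insert D S : Finset (Set (Matrix (Fin n) (Fin m) ℝ))) ≤ #Δ :=
    Cardinal.mk_le_mk_of_subset hsub
  rw [Cardinal.mk_coe_finset,
    Finset.card_insert_of_notMem fun h => hev.self_of_nhds D h hAD, hcard] at h
  exact_mod_cast h

theorem exists_rank_eq {n m k : ℕ} (hk : k ≤ min n (m - 1)) (hm : 1 ≤ m) :
    ∃ A : Matrix (Fin n) (Fin m) ℝ, A.rank = k := by
  induction k with
  | zero => exact ⟨0, Matrix.rank_zero⟩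
  | succ k ih =>
    obtain ⟨A, hA⟩ := ih (by omega)
    obtain ⟨y, hy⟩ := (linEq_nonempty_iff A).2 (by omega)
    obtain ⟨u, hu⟩ := exists_notMem_range_mulVecLin (A := A) (by omega)
    exact ⟨_, (rank_rankOnePerturb hu hy one_pos).trans (by rw [hA])⟩

/-! ### An explicit witness of `d`-discontinuity. -/

/-- A flag of matrices: row `i` of the matrix at `ν` is a multiple of the standard basis vector
with index `ν_i` modulo `m`, the factor tending to `0` as `ν_i` grows. -/
noncomputable def basisFlag (n m : ℕ) (hm : 0 < m) (ν : List ℕ) : Matrix (Fin n) (Fin m) ℝ :=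
  Matrix.of fun i => (ν[(i : ℕ)]?).elim 0 fun a =>
    Pi.single (⟨a % m, Nat.mod_lt a hm⟩ : Fin m) (1 / ((a : ℝ) + 1))

theorem basisFlag_mem_multiDom {n m : ℕ} (hm : 0 < m) {ν : List ℕ} (hν : ν.length < m) :
    basisFlag n m hm ν ∈ MultiDom (LinEq n m) := by
  classical
  -- Fewer than `m` entries miss some residue `j`, and the basis vector at `j` is then in the
  -- kernel.
  obtain ⟨j, hj⟩ : ∃ j : Fin m, j ∉ (ν.map fun a => (⟨a % m, Nat.mod_lt a hm⟩ : Fin m)) := by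
    by_contra! H
    have h1 := (List.subset_def.2 fun {j} (_ : j ∈ List.finRange m) => H j)
    have h2 := (List.subperm_of_subset (List.nodup_finRange m) h1).length_le
    simp at h2
    omega
  refine ⟨Pi.single j 1, mem_LinEq.2 ⟨?_, by simp⟩⟩
  ext i
  rw [Matrix.mulVec_single_one]
  cases h : ν[(i : ℕ)]? with
  | none => simp [basisFlag, h]
  | some a =>
    have ha : a ∈ ν := List.mem_of_getElem? h
    have : j ≠ (⟨a % m, Nat.mod_lt a hm⟩ : Fin m) := fun e =>
      hj (List.mem_map.2 ⟨a, ha, e.symm⟩)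
    simp [basisFlag, h, this]

theorem tendsto_basisFlag {n m : ℕ} (hm : 0 < m) (ν : List ℕ) (l : ℕ) :
    Tendsto (fun k => basisFlag n m hm (ν ++ List.replicate l k)) atTop
      (𝓝 (basisFlag n m hm ν)) := by
  refine tendsto_pi_nhds.2 fun i => tendsto_pi_nhds.2 fun j => ?_
  by_cases hi : (i : ℕ) < ν.length
  · simp only [basisFlag, Matrix.of_apply, List.getElem?_append_left hi]
    exact tendsto_const_nhds
  · rw [not_lt] at hi
    have h0 : basisFlag n m hm ν i j = 0 := by
      simp [basisFlag, List.getElem?_eq_none hi]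
    rw [h0]
    refine squeeze_zero (g := fun k : ℕ => 1 / ((k : ℝ) + 1)) (fun k => ?_) (fun k => ?_)
      tendsto_one_div_add_atTop_nhds_zero_nat
    all_goals
      simp only [basisFlag, Matrix.of_apply, List.getElem?_append_right hi,
        List.getElem?_replicate]
      split_ifs with h
      · simp only [Option.elim_some, Pi.single_apply]
        split_ifs <;> first | positivity | exact le_rfl
      · simp
        try positivity

theorem isKDiscontinuityWitness_basisFlag (n m d : ℕ) (hm : 0 < m) (hd : d = min n (m - 1)) :
    IsKDiscontinuityWitness (LinEq n m) d (basisFlag n m hm) := by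
  have hdom : ∀ ν : List ℕ, ν.length ≤ d → basisFlag n m hm ν ∈ MultiDom (LinEq n m) :=
    fun ν hν => basisFlag_mem_multiDom hm (by omega)
  refine ⟨hdom, fun ν l _ _ => tendsto_basisFlag hm ν l, fun ν l hl hνl =>
    ⟨hdom ν (by omega), fun k => hdom _ (by simpa using hνl), tendsto_basisFlag hm ν l,
      fun y hy => ?_⟩⟩
  obtain ⟨j, hj⟩ := Function.ne_iff.1 (mem_LinEq.1 hy).2
  refine ⟨{v | v j ≠ 0}, isOpen_ne_fun (continuous_apply j) continuous_const, hj, ?_⟩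
  rw [Filter.frequently_atTop]
  intro N
  -- An index beyond `N` with residue `j`: row `ν.length`, which exists as `ν.length < d ≤ n`,
  -- becomes a nonzero multiple of the `j`-th basis vector and forces `v j = 0`.
  refine ⟨N * m + j, (Nat.le_mul_of_pos_right N hm).trans (Nat.le_add_right _ _), ?_⟩
  rw [Set.disjoint_left]
  intro v hv hvj
  have hrow := congrFun (mem_LinEq.1 hv).1 ⟨ν.length, by omega⟩
  have hidx : (⟨(N * m + j) % m, Nat.mod_lt _ hm⟩ : Fin m) = j := by
    ext
    simp [Nat.mod_eq_of_lt j.isLt]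
  have hl' : 0 < l := hl
  simp only [Matrix.mulVec, basisFlag, Matrix.of_apply, List.getElem?_append_right le_rfl,
    Nat.sub_self, List.getElem?_replicate_of_lt hl', Option.elim_some, hidx, single_dotProduct,
    Pi.zero_apply, mul_eq_zero] at hrow
  rcases hrow with h | h
  · exact (Nat.one_div_pos_of_nat (n := N * m + j)).ne' h
  · exact hvj h

/-! ### Machine computability implies continuity. -/

theorem getElem?_eq_some_of_prefix {α : Type*} {l l' : List α} (h : l <+: l') {i : ℕ} {a : α}
    (ha : l[i]? = some a) : l'[i]? = some a := by
  obtain ⟨t, rfl⟩ := h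
  rw [List.getElem?_append_left (List.getElem?_eq_some_iff.1 ha).1, ha]

theorem map_range_prefix {α : Type*} (p : ℕ → α) {N N' : ℕ} (h : N ≤ N') :
    (List.range N).map p <+: (List.range N').map p := by
  obtain ⟨k, rfl⟩ := Nat.exists_eq_add_of_le h
  rw [List.range_add, List.map_append]
  exact List.prefix_append _ _

theorem Type2Machine.getElem?_run_mono (M : Type2Machine) (w : ℕ) (p : ℕ → ℕ) {N N' : ℕ}
    (h : N ≤ N') {i a : ℕ} (ha : (M.run w ((List.range N).map p))[i]? = some a) :
    (M.run w ((List.range N').map p))[i]? = some a :=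
  getElem?_eq_some_of_prefix (M.monotone w _ _ (map_range_prefix p h)) ha

/-- Finitely many output symbols depend on finitely many input symbols only. -/
theorem Type2Machine.Outputs.exists_modulus {M : Type2Machine} {w : ℕ} {p q : ℕ → ℕ}
    (h : M.Outputs w p q) (L : ℕ) :
    ∃ N, ∀ p' q', (∀ s < N, p' s = p s) → M.Outputs w p' q' → ∀ i < L, q' i = q i := by
  choose N hN using h
  refine ⟨(Finset.range L).sup N, fun p' q' hp hq i hi => ?_⟩
  have hNi : N i ≤ (Finset.range L).sup N := Finset.le_sup (Finset.mem_range.2 hi)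
  have h1 := hN i
  have heq : (List.range (N i)).map p = (List.range (N i)).map p' :=
    List.map_congr_left fun s hs => (hp s ((List.mem_range.1 hs).trans_le hNi)).symm
  rw [heq] at h1
  obtain ⟨N', h2⟩ := hq i
  have h3 := M.getElem?_run_mono w p' (le_max_left (N i) N') h1
  have h4 := M.getElem?_run_mono w p' (le_max_right (N i) N') h2
  rw [h3] at h4
  exact (Option.some.inj h4).symm

theorem rhoMatrix_isName_iff {n m : ℕ} {p : ℕ → ℕ} {A : Matrix (Fin n) (Fin m) ℝ} :
    (rhoMatrix n m).IsName p A ↔ ∀ (i : Fin n) (j : Fin m) (t : ℕ),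
      |A i j - (ratOfCode (p (n * (m * t + j) + i)) : ℝ)| ≤ 1 / 2 ^ t :=
  Iff.rfl

theorem rho_pow_isName_iff {m : ℕ} {q : ℕ → ℕ} {y : Fin m → ℝ} :
    (rho.pow m).IsName q y ↔ ∀ (j : Fin m) (t : ℕ),
      |y j - (ratOfCode (q (m * t + j)) : ℝ)| ≤ 1 / 2 ^ t :=
  Iff.rfl

/-- The spare factor two leaves room for moving `A`: a finite prefix of such a name also starts a
name of every sufficiently close matrix. Dropping the first round of `n * m` symbols of a name
provides it. -/
theorem exists_robust_name {n m : ℕ} (A : Matrix (Fin n) (Fin m) ℝ) :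
    ∃ p : ℕ → ℕ, ∀ (i : Fin n) (j : Fin m) (t : ℕ),
      |A i j - (ratOfCode (p (n * (m * t + j) + i)) : ℝ)| ≤ 1 / 2 ^ (t + 1) := by
  obtain ⟨p, hp⟩ := (rhoMatrix n m).surjective A
  rw [rhoMatrix_isName_iff] at hp
  refine ⟨fun s => p (s + n * m), fun i j t => ?_⟩
  convert hp i j (t + 1) using 6
  ring

/-- A multivalued mapping computed by a Type-2 machine on `D` is continuous on `D`. -/
theorem multiContinuousOn_of_machine {n m : ℕ}
    {f : Matrix (Fin n) (Fin m) ℝ → Set (Fin m → ℝ)} {D : Set (Matrix (Fin n) (Fin m) ℝ)}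
    (M : Type2Machine) (w : ℕ)
    (h : ∀ A ∈ D, ∀ p, (rhoMatrix n m).IsName p A →
      ∃ q, M.Outputs w p q ∧ ∃ y ∈ f A, (rho.pow m).IsName q y) :
    MultiContinuousOn f D := by
  intro A hA
  obtain ⟨p, hp⟩ := exists_robust_name A
  have hpA : (rhoMatrix n m).IsName p A := fun i j t =>
    (hp i j t).trans (one_div_le_one_div_of_le (by positivity)
      (pow_le_pow_right₀ one_le_two t.le_succ))
  obtain ⟨q, hq, y, hy, hqy⟩ := h A hA p hpA
  rw [rho_pow_isName_iff] at hqy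
  refine ⟨y, hy, fun V hV hyV => ?_⟩
  obtain ⟨ε, hε, hball⟩ := Metric.isOpen_iff.1 hV y hyV
  obtain ⟨t, ht⟩ := exists_pow_lt_of_lt_one (half_pos hε) (by norm_num : (1 / 2 : ℝ) < 1)
  rw [one_div_pow] at ht
  -- The first `m * t + m` output symbols include every coordinate at precision `t`.
  obtain ⟨N, hN⟩ := hq.exists_modulus (m * t + m)
  refine ⟨{B | ∀ i j, |B i j - A i j| < 1 / 2 ^ (N + 1)}, ?_, ?_⟩
  · refine eventually_all.2 fun i => eventually_all.2 fun j => ?_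
    have hc : Continuous fun B : Matrix (Fin n) (Fin m) ℝ => |B i j - A i j| := by fun_prop
    exact hc.continuousAt.eventually_lt continuousAt_const (by simp)
  · rintro B ⟨hBA, hBD⟩
    obtain ⟨pB, hpB⟩ := (rhoMatrix n m).surjective B
    rw [rhoMatrix_isName_iff] at hpB
    -- Splicing the prefix of `p` onto a name of `B` makes the machine repeat its first outputs.
    -- Symbols in the prefix have precision index at most `N`, so the radius `1 / 2 ^ (N + 1)` is
    -- small enough.
    have hname : (rhoMatrix n m).IsName (fun s => if s < N then p s else pB s) B := by
      refine rhoMatrix_isName_iff.2 fun i j s => ?_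
      split_ifs with hlt
      · have hs : s ≤ N := by
          have h1 : s ≤ m * s := Nat.le_mul_of_pos_left s j.pos
          have h2 : m * s + j ≤ n * (m * s + j) := Nat.le_mul_of_pos_left _ i.pos
          omega
        have h1 := (hBA i j).le
        have h2 := hp i j s
        have h3 : (1 : ℝ) / 2 ^ (N + 1) ≤ 1 / 2 ^ (s + 1) :=
          one_div_le_one_div_of_le (by positivity)
            (pow_le_pow_right₀ one_le_two (Nat.succ_le_succ hs))
        have h4 : (1 : ℝ) / 2 ^ s = 1 / 2 ^ (s + 1) + 1 / 2 ^ (s + 1) := by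
          rw [pow_succ]
          field_simp
          norm_num
        rw [h4]
        exact (abs_sub_le _ (A i j) _).trans (add_le_add (h1.trans h3) h2)
      · exact hpB i j s
    obtain ⟨q', hq', y', hy', hqy'⟩ := h B hBD _ hname
    rw [rho_pow_isName_iff] at hqy'
    refine ⟨y', hy', hball ?_⟩
    refine (dist_pi_lt_iff hε).2 fun j => ?_
    have h1 := hqy j t
    have h2 := hqy' j t
    rw [hN _ q' (fun s hs => if_pos hs) hq' (m * t + j) (by have := j.isLt; omega)] at h2
    rw [Real.dist_eq]
    rw [abs_le] at h1 h2
    rw [abs_lt]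
    constructor <;> linarith [h1.1, h1.2, h2.1, h2.2]

/-! ### Primitive recursive rational arithmetic. -/

/-- A rational valued function that is primitive recursive on the level of codes. -/
def PrimrecRat {α : Type*} [Primcodable α] (F : α → ℚ) : Prop :=
  ∃ h : α → ℕ, Primrec h ∧ ∀ a, ratOfCode (h a) = F a

namespace PrimrecRat

variable {α β : Type*} [Primcodable α] [Primcodable β]

theorem const (x : ℚ) : PrimrecRat fun _ : α => x := by
  obtain ⟨c, rfl⟩ := ratOfCode_surjective x
  exact ⟨fun _ => c, Primrec.const c, fun _ => rfl⟩

theorem comp {F : β → ℚ} (hF : PrimrecRat F) {g : α → β} (hg : Primrec g) :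
    PrimrecRat fun a => F (g a) := by
  obtain ⟨h, hh, hF⟩ := hF
  exact ⟨fun a => h (g a), hh.comp hg, fun a => hF _⟩

theorem ofParts {a b c : α → ℕ} (ha : Primrec a) (hb : Primrec b) (hc : Primrec c) :
    PrimrecRat fun x => ((a x : ℚ) - b x) / (c x + 1) :=
  ⟨fun x => Nat.pair (Nat.pair (a x) (b x)) (c x),
    Primrec₂.natPair.comp (Primrec₂.natPair.comp ha hb) hc, fun x => by simp [ratOfCode]⟩

theorem exists_parts {F : α → ℚ} (hF : PrimrecRat F) :
    ∃ a b c : α → ℕ, Primrec a ∧ Primrec b ∧ Primrec c ∧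
      ∀ x, F x = ((a x : ℚ) - b x) / (c x + 1) := by
  obtain ⟨h, hh, hF⟩ := hF
  have h1 := Primrec.unpair.comp hh
  have h2 := Primrec.unpair.comp (Primrec.fst.comp h1)
  exact ⟨_, _, _, Primrec.fst.comp h2, Primrec.snd.comp h2, Primrec.snd.comp h1,
    fun x => (hF x).symm⟩

theorem add {F G : α → ℚ} (hF : PrimrecRat F) (hG : PrimrecRat G) :
    PrimrecRat fun x => F x + G x := by
  obtain ⟨a, b, c, ha, hb, hc, hF⟩ := hF.exists_parts
  obtain ⟨a', b', c', ha', hb', hc', hG⟩ := hG.exists_parts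
  have hs := Primrec.succ.comp hc
  have hs' := Primrec.succ.comp hc'
  -- Codes store the denominator minus one, and `(c + 1) * (c' + 1) - 1 = c * (c' + 1) + c'`.
  have key := ofParts
    (Primrec.nat_add.comp (Primrec.nat_mul.comp ha hs') (Primrec.nat_mul.comp ha' hs))
    (Primrec.nat_add.comp (Primrec.nat_mul.comp hb hs') (Primrec.nat_mul.comp hb' hs))
    (Primrec.nat_add.comp (Primrec.nat_mul.comp hc hs') hc')
  convert key using 2 with x
  rw [hF, hG]
  push_cast
  have h1 : (c x : ℚ) + 1 ≠ 0 := by positivity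
  have h2 : (c' x : ℚ) + 1 ≠ 0 := by positivity
  have h3 : (c x : ℚ) * (c' x + 1) + c' x + 1 ≠ 0 := by positivity
  field_simp
  ring

theorem mul {F G : α → ℚ} (hF : PrimrecRat F) (hG : PrimrecRat G) :
    PrimrecRat fun x => F x * G x := by
  obtain ⟨a, b, c, ha, hb, hc, hF⟩ := hF.exists_parts
  obtain ⟨a', b', c', ha', hb', hc', hG⟩ := hG.exists_parts
  have hs' := Primrec.succ.comp hc'
  have key := ofParts
    (Primrec.nat_add.comp (Primrec.nat_mul.comp ha ha') (Primrec.nat_mul.comp hb hb'))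
    (Primrec.nat_add.comp (Primrec.nat_mul.comp ha hb') (Primrec.nat_mul.comp hb ha'))
    (Primrec.nat_add.comp (Primrec.nat_mul.comp hc hs') hc')
  convert key using 2 with x
  rw [hF, hG]
  push_cast
  have h1 : (c x : ℚ) + 1 ≠ 0 := by positivity
  have h2 : (c' x : ℚ) + 1 ≠ 0 := by positivity
  have h3 : (c x : ℚ) * (c' x + 1) + c' x + 1 ≠ 0 := by positivity
  field_simp
  ring

theorem lt {F G : α → ℚ} (hF : PrimrecRat F) (hG : PrimrecRat G) :
    PrimrecPred fun x => F x < G x := by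
  obtain ⟨a, b, c, ha, hb, hc, hF⟩ := hF.exists_parts
  obtain ⟨a', b', c', ha', hb', hc', hG⟩ := hG.exists_parts
  have hs := Primrec.succ.comp hc
  have hs' := Primrec.succ.comp hc'
  refine (Primrec.nat_lt.comp
    (Primrec.nat_add.comp (Primrec.nat_mul.comp ha hs') (Primrec.nat_mul.comp hb' hs))
    (Primrec.nat_add.comp (Primrec.nat_mul.comp ha' hs)
      (Primrec.nat_mul.comp hb hs'))).of_eq fun x => ?_
  rw [hF, hG, div_lt_div_iff₀ (by positivity) (by positivity), ← Nat.cast_lt (α := ℚ)]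
  push_cast
  constructor <;> intro h <;> linarith

theorem le {F G : α → ℚ} (hF : PrimrecRat F) (hG : PrimrecRat G) :
    PrimrecPred fun x => F x ≤ G x :=
  (hG.lt hF).not.of_eq fun _ => not_lt

theorem one_div_succ {t : α → ℕ} (ht : Primrec t) :
    PrimrecRat fun x => 1 / ((t x : ℚ) + 1) := by
  simpa using ofParts (Primrec.const 1) (Primrec.const 0) ht

theorem one_div_two_pow : PrimrecRat fun t : ℕ => 1 / (2 : ℚ) ^ t := by
  have hpow : Primrec₂ ((· ^ ·) : ℕ → ℕ → ℕ) := Primrec₂.unpaired'.1 Nat.Primrec.pow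
  have h : Primrec fun t : ℕ => 2 ^ t - 1 :=
    Primrec.pred.comp (hpow.comp (Primrec.const 2) Primrec.id)
  convert one_div_succ h using 3 with t
  have : ((2 ^ t - 1 + 1 : ℕ) : ℚ) = (2 : ℚ) ^ t := by
    rw [Nat.sub_add_cancel Nat.one_le_two_pow]
    push_cast
    rfl
  rw [← this]
  push_cast
  rfl

end PrimrecRat

/-! ### Effective approximation of real functions. -/

/-- The initial segment of length `N` of an infinite sequence. -/
def initSeg (p : ℕ → ℕ) (N : ℕ) : List ℕ := (List.range N).map p

@[simp] theorem length_initSeg (p : ℕ → ℕ) (N : ℕ) : (initSeg p N).length = N := by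
  simp [initSeg]

theorem take_initSeg (p : ℕ → ℕ) {N N' : ℕ} (h : N ≤ N') :
    (initSeg p N').take N = initSeg p N := by
  rw [initSeg, ← List.map_take, List.take_range, min_eq_left h, initSeg]

theorem initSeg_prefix (p : ℕ → ℕ) {N N' : ℕ} (h : N ≤ N') : initSeg p N <+: initSeg p N' :=
  map_range_prefix p h

/-- A real function that can be approximated effectively from initial segments (of length at
least `N₀`) of names, with explicit error bounds. -/
def Approximable {X : Type*} (α : TTERepresentation X) (N₀ : ℕ) (F : X → ℝ) : Prop :=
  ∃ q e : List ℕ → ℚ, PrimrecRat q ∧ PrimrecRat e ∧ ∀ x p, α.IsName p x →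
    (∀ N ≥ N₀, |F x - q (initSeg p N)| ≤ e (initSeg p N)) ∧
      Tendsto (fun N => (e (initSeg p N) : ℝ)) atTop (𝓝 0)

theorem tendsto_of_abs_sub_le {y : ℝ} {q e : ℕ → ℝ} {N₀ : ℕ}
    (h : ∀ N ≥ N₀, |y - q N| ≤ e N) (he : Tendsto e atTop (𝓝 0)) : Tendsto q atTop (𝓝 y) := by
  refine tendsto_iff_dist_tendsto_zero.2 (squeeze_zero' (Eventually.of_forall fun _ =>
    dist_nonneg) ?_ he)
  filter_upwards [eventually_ge_atTop N₀] with N hN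
  rw [dist_comm, Real.dist_eq]
  exact h N hN

namespace Approximable

variable {X : Type*} {α : TTERepresentation X} {N₀ : ℕ}

theorem const (x : ℚ) : Approximable α N₀ fun _ => (x : ℝ) :=
  ⟨fun _ => x, fun _ => 0, PrimrecRat.const _, PrimrecRat.const _, fun _ _ _ => by simp⟩

theorem add {F G : X → ℝ} (hF : Approximable α N₀ F) (hG : Approximable α N₀ G) :
    Approximable α N₀ fun x => F x + G x := by
  obtain ⟨q, e, hq, he, hF⟩ := hF
  obtain ⟨q', e', hq', he', hG⟩ := hG
  refine ⟨_, _, hq.add hq', he.add he', fun x p hp => ⟨fun N hN => ?_, ?_⟩⟩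
  · have h1 := (hF x p hp).1 N hN
    have h2 := (hG x p hp).1 N hN
    push_cast
    rw [add_sub_add_comm]
    exact (abs_add_le _ _).trans (add_le_add h1 h2)
  · simpa using (hF x p hp).2.add (hG x p hp).2

theorem mul {F G : X → ℝ} (hF : Approximable α N₀ F) (hG : Approximable α N₀ G) :
    Approximable α N₀ fun x => F x * G x := by
  obtain ⟨q, e, hq, he, hF⟩ := hF
  obtain ⟨q', e', hq', he', hG⟩ := hG
  -- Since `|z| ≤ z * z + 1`, the error of a product is bounded by sums and products alone. It tends
  -- to `0` because `q` and `q'` converge.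
  refine ⟨_, _, hq.mul hq',
    ((((hq.mul hq).add (PrimrecRat.const 1)).mul he').add
      (((hq'.mul hq').add (PrimrecRat.const 1)).mul he)).add (he.mul he'),
    fun x p hp => ⟨fun N hN => ?_, ?_⟩⟩
  · have h1 := (hF x p hp).1 N hN
    have h2 := (hG x p hp).1 N hN
    push_cast
    generalize ((q (initSeg p N) : ℚ) : ℝ) = a at *
    generalize ((q' (initSeg p N) : ℚ) : ℝ) = b at *
    generalize ((e (initSeg p N) : ℚ) : ℝ) = c at *
    generalize ((e' (initSeg p N) : ℚ) : ℝ) = d at *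
    have hb : ∀ z : ℝ, |z| ≤ z * z + 1 := fun z => by
      rw [abs_le]
      constructor <;> nlinarith [sq_nonneg (z - 1), sq_nonneg (z + 1)]
    have hid : F x * G x - a * b = a * (G x - b) + b * (F x - a) + (F x - a) * (G x - b) := by
      ring
    rw [hid]
    refine (abs_add_three _ _ _).trans ?_
    rw [abs_mul, abs_mul, abs_mul]
    have := abs_nonneg (F x - a)
    have := abs_nonneg (G x - b)
    gcongr
    · nlinarith [mul_self_nonneg a]
    · exact hb a
    · nlinarith [mul_self_nonneg b]
    · exact hb b
    · linarith
  · have h1 := tendsto_of_abs_sub_le (hF x p hp).1 (hF x p hp).2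
    have h2 := tendsto_of_abs_sub_le (hG x p hp).1 (hG x p hp).2
    have h3 := (hF x p hp).2
    have h4 := (hG x p hp).2
    have := ((((h1.mul h1).add_const 1).mul h4).add
      (((h2.mul h2).add_const 1).mul h3)).add (h3.mul h4)
    simpa using this

theorem sum {ι : Type*} (s : Finset ι) {F : ι → X → ℝ} (h : ∀ i ∈ s, Approximable α N₀ (F i)) :
    Approximable α N₀ fun x => ∑ i ∈ s, F i x := by
  classical
  induction s using Finset.induction_on with
  | empty => simpa using const (α := α) (N₀ := N₀) 0
  | insert i s hi ih =>
    simp only [Finset.sum_insert hi]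
    exact (h i (Finset.mem_insert_self _ _)).add
      (ih fun j hj => h j (Finset.mem_insert_of_mem hj))

theorem prod {ι : Type*} (s : Finset ι) {F : ι → X → ℝ} (h : ∀ i ∈ s, Approximable α N₀ (F i)) :
    Approximable α N₀ fun x => ∏ i ∈ s, F i x := by
  classical
  induction s using Finset.induction_on with
  | empty => simpa using const (α := α) (N₀ := N₀) 1
  | insert i s hi ih =>
    simp only [Finset.prod_insert hi]
    exact (h i (Finset.mem_insert_self _ _)).mul
      (ih fun j hj => h j (Finset.mem_insert_of_mem hj))

/-- The Leibniz formula needs only sums and products, hence no division. -/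
theorem det {k : ℕ} {B : X → Matrix (Fin k) (Fin k) ℝ}
    (h : ∀ i j, Approximable α N₀ fun x => B x i j) : Approximable α N₀ fun x => (B x).det := by
  simp only [Matrix.det_apply']
  refine sum _ fun σ _ => ?_
  refine mul ?_ (prod _ fun i _ => h _ _)
  convert const (α := α) (N₀ := N₀) ((Equiv.Perm.sign σ : ℤ) : ℚ)
  simp

theorem cramer {k : ℕ} {B : X → Matrix (Fin k) (Fin k) ℝ} {b : X → Fin k → ℝ}
    (hB : ∀ i j, Approximable α N₀ fun x => B x i j) (hb : ∀ i, Approximable α N₀ fun x => b x i)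
    (i : Fin k) : Approximable α N₀ fun x => Matrix.cramer (B x) (b x) i := by
  simp only [Matrix.cramer_apply]
  refine det fun i' j => ?_
  by_cases hj : j = i
  · subst hj
    simpa using hb i'
  · simpa [Matrix.updateCol_ne hj] using hB i' j

/-- The entries of a matrix can be approximated from a name of it. -/
theorem entry {n m : ℕ} (i : Fin n) (j : Fin m) :
    Approximable (rhoMatrix n m) (n * m) fun A => A i j := by
  have hnm : 0 < n * m := Nat.mul_pos i.pos j.pos
  -- The last complete round of `n * m` symbols, giving error `1 / 2 ^ t ≤ 1 / (t + 1)`. At least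
  -- one round must have been read, whence the threshold `n * m`.
  have ht : Primrec fun σ : List ℕ => σ.length / (n * m) - 1 :=
    Primrec.pred.comp (Primrec.nat_div.comp Primrec.list_length (Primrec.const _))
  have hidx : Primrec fun σ : List ℕ =>
      σ.getD (n * (m * (σ.length / (n * m) - 1) + j) + i) 0 :=
    (Primrec.list_getD 0).comp Primrec.id
      (Primrec.nat_add.comp (Primrec.nat_mul.comp (Primrec.const n)
        (Primrec.nat_add.comp (Primrec.nat_mul.comp (Primrec.const m) ht) (Primrec.const _)))
        (Primrec.const _))
  refine ⟨_, _, ⟨_, hidx, fun _ => rfl⟩, PrimrecRat.one_div_succ ht,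
    fun A p hp => ⟨fun N hN => ?_, ?_⟩⟩
  · rw [rhoMatrix_isName_iff] at hp
    simp only [length_initSeg]
    set t := N / (n * m) - 1 with htdef
    have h1 : 1 ≤ N / (n * m) := (Nat.one_le_div_iff hnm).2 hN
    have hlt : n * (m * t + j) + i < N := by
      have h2 : n * m * (t + 1) ≤ N := by
        rw [htdef, Nat.sub_add_cancel h1]
        exact Nat.mul_div_le N (n * m)
      have h3 : n * (m * t + j) + i < n * (m * t + j + 1) := by
        rw [Nat.mul_succ]
        exact Nat.add_lt_add_left i.isLt _
      have h4 : n * (m * t + j + 1) ≤ n * (m * (t + 1)) := by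
        refine Nat.mul_le_mul_left n ?_
        rw [Nat.mul_succ, Nat.add_assoc]
        exact Nat.add_le_add_left j.isLt _
      rw [← mul_assoc] at h4
      omega
    have hget : (initSeg p N).getD (n * (m * t + j) + i) 0 = p (n * (m * t + j) + i) := by
      simp [initSeg, List.getD, List.getElem?_range hlt]
    rw [hget]
    refine (hp i j t).trans ?_
    push_cast
    refine one_div_le_one_div_of_le (by positivity) ?_
    exact_mod_cast Nat.lt_two_pow_self
  · have h1 : Tendsto (fun N : ℕ => N / (n * m) - 1) atTop atTop :=
      (tendsto_sub_atTop_nat 1).comp (Nat.tendsto_div_const_atTop hnm.ne')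
    have h2 := (tendsto_one_div_add_atTop_nhds_zero_nat (𝕜 := ℝ)).comp h1
    refine h2.congr fun N => ?_
    simp

/-- Positivity is semidecidable: `e < q` certifies it past `N₀`, and holds once `e` drops below half
of `F x`. -/
theorem exists_lt {F : X → ℝ} {q e : List ℕ → ℚ} {x : X} {p : ℕ → ℕ} (hx : 0 < F x)
    (h : ∀ N ≥ N₀, |F x - q (initSeg p N)| ≤ e (initSeg p N))
    (he : Tendsto (fun N => (e (initSeg p N) : ℝ)) atTop (𝓝 0)) :
    ∃ N ≥ N₀, e (initSeg p N) < q (initSeg p N) := by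
  obtain ⟨N, h1, h2⟩ := ((eventually_ge_atTop N₀).and
    (he.eventually (gt_mem_nhds (half_pos hx)))).exists
  refine ⟨N, h1, ?_⟩
  have h3 := abs_le.1 (h N h1)
  have : (e (initSeg p N) : ℝ) < q (initSeg p N) := by linarith [h3.1, h3.2]
  exact_mod_cast this

end Approximable

/-! ### Monotone search and streaming output. -/

section FirstSome

variable {β γ : Type*}

/-- The first value that `g` returns on an initial segment of `σ`. -/
def firstSome (g : List ℕ → Option β) (σ : List ℕ) : Option β :=
  ((List.range (σ.length + 1)).filterMap fun N => g (σ.take N)).head?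

theorem primrec_firstSome [Primcodable β] [Primcodable γ] {G : γ → List ℕ → Option β}
    (hG : Primrec₂ G) : Primrec₂ fun c σ => firstSome (G c) σ :=
  Primrec.list_head?.comp (Primrec.listFilterMap
    (Primrec.list_range.comp (Primrec.succ.comp (Primrec.list_length.comp Primrec.snd)))
    (hG.comp (Primrec.fst.comp Primrec.fst)
      (Primrec.list_take.comp Primrec.snd (Primrec.snd.comp Primrec.fst))))

/-- A longer input only appends candidates to the search list. An arbitrary test `g` thereby becomes
a commitment that is never revised. -/
theorem firstSome_mono (g : List ℕ → Option β) {σ τ : List ℕ} (h : σ <+: τ) {b : β}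
    (hb : firstSome g σ = some b) : firstSome g τ = some b := by
  have h1 : (List.range (σ.length + 1)).filterMap (fun N => g (σ.take N)) <+:
      (List.range (τ.length + 1)).filterMap fun N => g (τ.take N) := by
    have h2 : (List.range (σ.length + 1)).filterMap (fun N => g (σ.take N)) =
        (List.range (σ.length + 1)).filterMap (fun N => g (τ.take N)) := by
      refine List.filterMap_congr fun N hN => ?_
      obtain ⟨t, rfl⟩ := h
      rw [List.take_append_of_le_length (Nat.lt_succ_iff.1 (List.mem_range.1 hN))]
    rw [h2]
    refine List.IsPrefix.filterMap _ ?_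
    simpa using map_range_prefix id (Nat.succ_le_succ h.length_le)
  rw [firstSome, List.head?_eq_getElem?] at hb ⊢
  exact getElem?_eq_some_of_prefix h1 hb

theorem exists_firstSome_initSeg {g : List ℕ → Option β} {p : ℕ → ℕ}
    (h : ∃ N, (g (initSeg p N)).isSome) :
    ∃ b N₁, (∀ N ≥ N₁, firstSome g (initSeg p N) = some b) ∧ ∃ N, g (initSeg p N) = some b := by
  obtain ⟨N, hN⟩ := h
  obtain ⟨b', hb'⟩ := Option.isSome_iff_exists.1 hN
  have hmem : b' ∈ (List.range ((initSeg p N).length + 1)).filterMap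
      fun N' => g ((initSeg p N).take N') :=
    List.mem_filterMap.2 ⟨N, by simp, by rw [take_initSeg p le_rfl, hb']⟩
  obtain ⟨b, hb⟩ : ∃ b, firstSome g (initSeg p N) = some b :=
    ⟨_, List.head?_eq_some_head (List.ne_nil_of_mem hmem)⟩
  refine ⟨b, N, fun N' hN' => firstSome_mono g (initSeg_prefix p hN') hb, ?_⟩
  obtain ⟨N', h1, h2⟩ := List.mem_filterMap.1 (List.mem_of_head? hb)
  rw [take_initSeg p (by simpa [Nat.lt_succ_iff] using h1)] at h2
  exact ⟨N', h2⟩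

theorem primrec_bind_firstSome {K m : ℕ} (hm : 0 < m) {sel : ℕ → List ℕ → Option (Fin K)}
    {val : Fin K → Fin m → ℕ → List ℕ → Option ℕ} (hsel : Primrec₂ sel)
    (hval : Primrec₂ fun (x : Fin K × Fin m × ℕ) (σ : List ℕ) => val x.1 x.2.1 x.2.2 σ) :
    Primrec fun x : (ℕ × ℕ) × List ℕ => (firstSome (sel x.1.1) x.2).bind fun c =>
      firstSome (val c ⟨x.1.2 % m, Nat.mod_lt _ hm⟩ (x.1.2 / m)) x.2 := by
  refine Primrec.option_bind
    ((primrec_firstSome hsel).comp (Primrec.fst.comp Primrec.fst) Primrec.snd) ?_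
  have hi : Primrec fun x : ((ℕ × ℕ) × List ℕ) × Fin K => x.1.1.2 :=
    Primrec.snd.comp (Primrec.fst.comp Primrec.fst)
  have hmod : Primrec fun x : ((ℕ × ℕ) × List ℕ) × Fin K =>
      (⟨x.1.1.2 % m, Nat.mod_lt _ hm⟩ : Fin m) :=
    Primrec.fin_val_iff.1 (Primrec.nat_mod.comp hi (Primrec.const m))
  exact (primrec_firstSome (G := fun x : Fin K × Fin m × ℕ => val x.1 x.2.1 x.2.2) hval).comp (Primrec.pair Primrec.snd
    (Primrec.pair hmod (Primrec.nat_div.comp hi (Primrec.const m))))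
    (Primrec.snd.comp Primrec.fst)

end FirstSome

section StreamMachine

/-- The number of consecutive output symbols available after reading `σ`. -/
def outputLength (out : ℕ → List ℕ → Option ℕ) (σ : List ℕ) : ℕ :=
  Nat.findGreatest (fun k => ∀ j < k, (out j σ).isSome) σ.length

theorem outputLength_mono {out : ℕ → List ℕ → Option ℕ}
    (h : ∀ i σ τ b, σ <+: τ → out i σ = some b → out i τ = some b) {σ τ : List ℕ}
    (hστ : σ <+: τ) : outputLength out σ ≤ outputLength out τ := by
  refine Nat.le_findGreatest ((Nat.findGreatest_le _).trans hστ.length_le) fun j hj => ?_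
  have h1 : ∀ j < outputLength out σ, (out j σ).isSome :=
    Nat.findGreatest_spec (P := fun k => ∀ j < k, (out j σ).isSome) (Nat.zero_le _) (by simp)
  obtain ⟨b, hb⟩ := Option.isSome_iff_exists.1 (h1 j hj)
  rw [h j σ τ b hστ hb, Option.isSome_some]

theorem isSome_of_lt_outputLength {out : ℕ → List ℕ → Option ℕ} {σ : List ℕ} {j : ℕ}
    (hj : j < outputLength out σ) : (out j σ).isSome :=
  Nat.findGreatest_spec (P := fun k => ∀ j < k, (out j σ).isSome) (Nat.zero_le _) (by simp) j hj

/-- The machine that writes the symbols `out w 0 σ, out w 1 σ, …` as long as they are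
available. -/
def streamMachine (out : ℕ → ℕ → List ℕ → Option ℕ)
    (hout : Primrec fun x : (ℕ × ℕ) × List ℕ => out x.1.1 x.1.2 x.2)
    (hmono : ∀ w i σ τ b, σ <+: τ → out w i σ = some b → out w i τ = some b) :
    Type2Machine where
  -- The default `0` is never written, since all positions below `outputLength` are filled.
  run w σ := (List.range (outputLength (out w) σ)).map fun i => (out w i σ).getD 0
  computable := by
    have hR : PrimrecRel fun (j : ℕ) (x : ℕ × List ℕ) => ((out x.1 j x.2).isSome : Prop) :=
      Primrec.eq.comp (Primrec.option_isSome.comp (hout.comp (Primrec.pair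
        (Primrec.pair (Primrec.fst.comp Primrec.snd) Primrec.fst)
        (Primrec.snd.comp Primrec.snd)))) (Primrec.const true)
    have hlen : Primrec fun x : ℕ × List ℕ => outputLength (out x.1) x.2 :=
      Primrec.nat_findGreatest (Primrec.list_length.comp Primrec.snd)
        ((hR.forall_mem_list.comp (Primrec.list_range.comp Primrec.snd) Primrec.fst).of_eq
          fun x => by simp)
    refine Primrec.to_comp (Primrec.list_map (Primrec.list_range.comp hlen) ?_)
    exact Primrec.option_getD.comp (hout.comp (Primrec.pair
      (Primrec.pair (Primrec.fst.comp Primrec.fst) Primrec.snd)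
      (Primrec.snd.comp Primrec.fst))) (Primrec.const 0)
  monotone w σ τ h := by
    have h1 : (List.range (outputLength (out w) σ)).map (fun i => (out w i σ).getD 0) =
        (List.range (outputLength (out w) σ)).map fun i => (out w i τ).getD 0 := by
      refine List.map_congr_left fun i hi => ?_
      obtain ⟨b, hb⟩ := Option.isSome_iff_exists.1
        (isSome_of_lt_outputLength (List.mem_range.1 hi))
      rw [hb, hmono w i σ τ b h hb]
    rw [h1]
    exact map_range_prefix _ (outputLength_mono (hmono w) h)

theorem streamMachine_outputs {out : ℕ → ℕ → List ℕ → Option ℕ}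
    {hout : Primrec fun x : (ℕ × ℕ) × List ℕ => out x.1.1 x.1.2 x.2}
    {hmono : ∀ w i σ τ b, σ <+: τ → out w i σ = some b → out w i τ = some b}
    {w : ℕ} {p q : ℕ → ℕ} (h : ∀ i, ∃ N, out w i (initSeg p N) = some (q i)) :
    (streamMachine out hout hmono).Outputs w p q := by
  choose N hN using h
  intro i
  -- `L` has to exceed `i` because `outputLength` is capped by the number of symbols read.
  set L := max (i + 1) ((Finset.range (i + 1)).sup N) with hL
  have hout' : ∀ j < i + 1, out w j (initSeg p L) = some (q j) := fun j hj =>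
    hmono w j _ _ _ (initSeg_prefix p
      ((Finset.le_sup (Finset.mem_range.2 hj)).trans (le_max_right _ _))) (hN j)
  have hlen : i < outputLength (out w) (initSeg p L) := by
    refine Nat.le_findGreatest (by simp [hL]) fun j hj => ?_
    rw [hout' j hj, Option.isSome_some]
  refine ⟨L, ?_⟩
  change ((List.range (outputLength (out w) (initSeg p L))).map
    fun i => (out w i (initSeg p L)).getD 0)[i]? = _
  rw [List.getElem?_map, List.getElem?_range hlen, Option.map_some,
    hout' i (Nat.lt_succ_self i), Option.getD_some]

end StreamMachine

/-! ### A machine from finitely many approximable selections. -/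

/-- A multivalued mapping is computable from the value of `g` when it has finitely many
approximable selections, each of them valid where an approximable function is positive and `g`
has a prescribed value, such that one of them is always valid. -/
theorem isComputableKnowing_of_approximable {X : Type u} {α : TTERepresentation X} {N₀ m K : ℕ}
    (hm : 0 < m) {f : X → Set (Fin m → ℝ)} {g : X → ℕ} (r : Fin K → ℕ) (D : Fin K → X → ℝ)
    (Y : Fin K → X → Fin m → ℝ) (hD : ∀ c, Approximable α N₀ (D c))
    (hY : ∀ c j, Approximable α N₀ fun x => Y c x j)
    (hsound : ∀ c, ∀ x ∈ MultiDom f, g x = r c → 0 < D c x → Y c x ∈ f x)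
    (hcomplete : ∀ x ∈ MultiDom f, ∃ c, g x = r c ∧ 0 < D c x) :
    IsComputableKnowing α (rho.pow m) f g := by
  classical
  choose q e hq he hqe using hD
  choose q' e' hq' he' hqe' using hY
  choose h hh hhq using hq'
  -- `sel` looks for a selection matching the advice whose validity is certified by `e < q`; `val`
  -- looks for an approximation of precision `t`.
  let sel : ℕ → List ℕ → Option (Fin K) := fun w σ =>
    ((List.finRange K).filterMap fun c =>
      if r c = w ∧ N₀ ≤ σ.length ∧ e c σ < q c σ then some c else none).head?
  let val : Fin K → Fin m → ℕ → List ℕ → Option ℕ := fun c j t σ =>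
    if N₀ ≤ σ.length ∧ e' c j σ ≤ 1 / 2 ^ t then some (h c j σ) else none
  have hsel : Primrec₂ sel := by
    refine Primrec.list_head?.comp (Primrec.listFilterMap (Primrec.const _) ?_)
    have key : Primrec₂ fun (c : Fin K) (x : ℕ × List ℕ) =>
        if r c = x.1 ∧ N₀ ≤ x.2.length ∧ e c x.2 < q c x.2 then some c else none := by
      refine Primrec.fin_curry₁.2 fun c => Primrec.ite ?_ (Primrec.const _) (Primrec.const _)
      exact (Primrec.eq.comp (Primrec.const _) Primrec.fst).and
        ((Primrec.nat_le.comp (Primrec.const _) (Primrec.list_length.comp Primrec.snd)).and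
          (((he c).comp Primrec.snd).lt ((hq c).comp Primrec.snd)))
    exact key.swap
  have hval : Primrec₂ fun (x : Fin K × Fin m × ℕ) (σ : List ℕ) => val x.1 x.2.1 x.2.2 σ := by
    have key : ∀ c, Primrec₂ fun (j : Fin m) (x : ℕ × List ℕ) => val c j x.1 x.2 := by
      refine fun c => Primrec.fin_curry₁.2 fun j => Primrec.ite ?_
        (Primrec.option_some.comp ((hh c j).comp Primrec.snd)) (Primrec.const _)
      exact (Primrec.nat_le.comp (Primrec.const _) (Primrec.list_length.comp Primrec.snd)).and
        (((he' c j).comp Primrec.snd).le (PrimrecRat.one_div_two_pow.comp Primrec.fst))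
    have key' : Primrec₂ fun (c : Fin K) (x : Fin m × ℕ × List ℕ) => val c x.1 x.2.1 x.2.2 :=
      Primrec.fin_curry₁.2 fun c => key c
    exact key'.comp (Primrec.fst.comp Primrec.fst)
      (Primrec.pair (Primrec.fst.comp (Primrec.snd.comp Primrec.fst))
        (Primrec.pair (Primrec.snd.comp (Primrec.snd.comp Primrec.fst)) Primrec.snd))
  -- All symbols depend on the same committed `c`, so they describe a single solution. Symbol `i` is
  -- coordinate `i % m` at precision `i / m`.
  let out : ℕ → ℕ → List ℕ → Option ℕ := fun w i σ =>
    (firstSome (sel w) σ).bind fun c => firstSome (val c ⟨i % m, Nat.mod_lt i hm⟩ (i / m)) σ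
  have hout : Primrec fun x : (ℕ × ℕ) × List ℕ => out x.1.1 x.1.2 x.2 :=
    primrec_bind_firstSome hm hsel hval
  have hmono : ∀ w i σ τ b, σ <+: τ → out w i σ = some b → out w i τ = some b := by
    intro w i σ τ b hστ hb
    obtain ⟨c, hc, hcb⟩ := Option.bind_eq_some_iff.1 hb
    exact Option.bind_eq_some_iff.2 ⟨c, firstSome_mono _ hστ hc, firstSome_mono _ hστ hcb⟩
  refine ⟨streamMachine out hout hmono, fun x hx p hp => ?_⟩
  obtain ⟨c, N₁, hc, N₂, hcN⟩ : ∃ c N₁, (∀ N ≥ N₁, firstSome (sel (g x)) (initSeg p N) = some c) ∧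
      ∃ N, sel (g x) (initSeg p N) = some c := by
    refine exists_firstSome_initSeg ?_
    obtain ⟨c, hgc, hDc⟩ := hcomplete x hx
    obtain ⟨N, hN, hlt⟩ := Approximable.exists_lt hDc (hqe c x p hp).1 (hqe c x p hp).2
    refine ⟨N, ?_⟩
    exact Option.isSome_iff_exists.2 ⟨_, List.head?_eq_some_head (List.ne_nil_of_mem (a := c)
      (List.mem_filterMap.2 ⟨c, List.mem_finRange c, by simp [hgc, hN, hlt]⟩))⟩
  have hYf : Y c x ∈ f x := by
    obtain ⟨c', -, hc'⟩ := List.mem_filterMap.1 (List.mem_of_head? hcN)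
    split_ifs at hc' with hcond
    obtain rfl := Option.some.inj hc'
    refine hsound c' x hx hcond.1.symm ?_
    rw [length_initSeg] at hcond
    have h1 := abs_le.1 ((hqe c' x p hp).1 N₂ hcond.2.1)
    have h2 : (e c' (initSeg p N₂) : ℝ) < q c' (initSeg p N₂) := by exact_mod_cast hcond.2.2
    linarith [h1.1]
  have hoi : ∀ i, ∃ a N, out (g x) i (initSeg p N) = some a ∧
      |Y c x ⟨i % m, Nat.mod_lt i hm⟩ - (ratOfCode a : ℝ)| ≤ 1 / 2 ^ (i / m) := by
    intro i
    set j : Fin m := ⟨i % m, Nat.mod_lt i hm⟩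
    have hap := hqe' c j x p hp
    obtain ⟨a, N₃, ha, N₄, haN⟩ := exists_firstSome_initSeg (g := val c j (i / m)) (p := p) (by
      obtain ⟨N, h1, h2⟩ := ((eventually_ge_atTop N₀).and (hap.2.eventually
        (gt_mem_nhds (by positivity : (0 : ℝ) < 1 / 2 ^ (i / m))))).exists
      have h3 : e' c j (initSeg p N) ≤ 1 / 2 ^ (i / m) := by
        rw [← Rat.cast_le (K := ℝ)]
        push_cast
        exact h2.le
      refine ⟨N, ?_⟩
      simp only [val]
      rw [if_pos ⟨by simpa using h1, h3⟩, Option.isSome_some])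
    refine ⟨a, max N₁ N₃, Option.bind_eq_some_iff.2
      ⟨c, hc _ (le_max_left _ _), ha _ (le_max_right _ _)⟩, ?_⟩
    simp only [val] at haN
    split_ifs at haN with hcond
    obtain rfl := Option.some.inj haN
    rw [length_initSeg] at hcond
    rw [hhq]
    refine (hap.1 N₄ hcond.1).trans ?_
    have h3 := Rat.cast_le (K := ℝ) |>.2 hcond.2
    push_cast at h3
    exact h3
  choose a hN ha using hoi
  refine ⟨a, streamMachine_outputs fun i => ⟨_, ha i |>.1⟩, Y c x, hYf, ?_⟩
  rw [rho_pow_isName_iff]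
  intro j t
  have h1 := (ha (m * t + j)).2
  have h2 : (m * t + (j : ℕ)) % m = j := by
    rw [Nat.mul_add_mod, Nat.mod_eq_of_lt j.isLt]
  have h3 : (m * t + (j : ℕ)) / m = t := by
    rw [Nat.mul_add_div hm, Nat.div_eq_of_lt j.isLt, add_zero]
  simpa only [h2, h3] using h1

/-! ### Kernel vectors from minors by Cramer's rule. -/

theorem exists_linearIndependent_rows {n m r : ℕ} {A : Matrix (Fin n) (Fin m) ℝ}
    (hr : A.rank = r) : ∃ I : Fin r → Fin n, LinearIndependent ℝ fun i => A (I i) := by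
  subst hr
  rw [A.rank_eq_finrank_span_row]
  obtain ⟨f, hf, -, hli⟩ := Submodule.exists_fun_fin_finrank_span_eq ℝ (Set.range A.row)
  choose I hI using hf
  refine ⟨I, ?_⟩
  have h : (fun i => A (I i)) = f := funext hI
  rw [h]
  exact hli

theorem exists_minor_ne_zero {n m r : ℕ} {A : Matrix (Fin n) (Fin m) ℝ} (hr : A.rank = r) :
    ∃ (I : Fin r → Fin n) (J : Fin r → Fin m), (A.submatrix I J).det ≠ 0 := by
  obtain ⟨I, hI⟩ := exists_linearIndependent_rows hr
  have hB : (A.submatrix I id).transpose.rank = r := by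
    rw [Matrix.rank_transpose]
    simpa using LinearIndependent.rank_matrix (M := A.submatrix I id) hI
  obtain ⟨J, hJ⟩ := exists_linearIndependent_rows hB
  have hu : IsUnit (A.submatrix I J).transpose := Matrix.linearIndependent_rows_iff_isUnit.1 hJ
  rw [Matrix.isUnit_transpose, Matrix.isUnit_iff_isUnit_det] at hu
  exact ⟨I, J, hu.ne_zero⟩

/-- The selected rows are independent, being so already on the columns `J`; `r` independent vectors
span the `r`-dimensional row space. -/
theorem row_mem_span_of_minor_ne_zero {n m r : ℕ} {A : Matrix (Fin n) (Fin m) ℝ}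
    (hr : A.rank = r) {I : Fin r → Fin n} {J : Fin r → Fin m}
    (hdet : (A.submatrix I J).det ≠ 0) (i : Fin n) :
    A i ∈ Submodule.span ℝ (Set.range fun k => A (I k)) := by
  have hu : IsUnit (A.submatrix I J) :=
    (Matrix.isUnit_iff_isUnit_det _).2 (isUnit_iff_ne_zero.2 hdet)
  have h1 : LinearIndependent ℝ (A.submatrix I J).row :=
    Matrix.linearIndependent_rows_iff_isUnit.2 hu
  have h2 : LinearIndependent ℝ fun k => A (I k) :=
    LinearIndependent.of_comp (LinearMap.funLeft ℝ ℝ J) h1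
  have hle : Submodule.span ℝ (Set.range fun k => A (I k)) ≤
      Submodule.span ℝ (Set.range A.row) := by
    refine Submodule.span_mono ?_
    rintro _ ⟨k, rfl⟩
    exact ⟨I k, rfl⟩
  rw [Submodule.eq_of_le_of_finrank_eq hle]
  · exact Submodule.subset_span ⟨i, rfl⟩
  · rw [← A.rank_eq_finrank_span_row, hr, finrank_span_eq_card h2, Fintype.card_fin]

/-- The vector that Cramer's rule yields for the minor with rows `I` and columns `J` and the
right-hand side given by column `j₀`. -/
noncomputable def cramerVector {n m r : ℕ} (A : Matrix (Fin n) (Fin m) ℝ) (I : Fin r → Fin n)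
    (J : Fin r → Fin m) (j₀ : Fin m) : Fin m → ℝ := fun j =>
  -- Only sums and products appear, matching the closure properties of `Approximable`.
  (if j = j₀ then (A.submatrix I J).det else 0) + (-1) * ∑ k,
    if j = J k then Matrix.cramer (A.submatrix I J) (fun i => A (I i) j₀) k else 0

theorem dotProduct_cramerVector {n m r : ℕ} (A : Matrix (Fin n) (Fin m) ℝ) (I : Fin r → Fin n)
    (J : Fin r → Fin m) (j₀ : Fin m) (v : Fin m → ℝ) :
    v ⬝ᵥ cramerVector A I J j₀ = v j₀ * (A.submatrix I J).det -
      ∑ k, v (J k) * Matrix.cramer (A.submatrix I J) (fun i => A (I i) j₀) k := by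
  simp only [dotProduct, cramerVector, mul_add, Finset.sum_add_distrib, mul_ite, mul_zero,
    Finset.sum_ite_eq', Finset.mem_univ, if_true]
  rw [sub_eq_add_neg]
  congr 1
  simp only [neg_one_mul, mul_neg, Finset.mul_sum, mul_ite, mul_zero]
  rw [Finset.sum_comm]
  simp

/-- For `B` the submatrix, `B *ᵥ cramer B b = det B • b` annihilates the selected rows, which span
all rows. As `j₀` avoids `J`, the coordinate at `j₀` is the nonzero minor. -/
theorem cramerVector_mem_linEq {n m r : ℕ} {A : Matrix (Fin n) (Fin m) ℝ} (hr : A.rank = r)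
    {I : Fin r → Fin n} {J : Fin r → Fin m} (hdet : (A.submatrix I J).det ≠ 0) {j₀ : Fin m}
    (hj₀ : ∀ k, j₀ ≠ J k) : cramerVector A I J j₀ ∈ LinEq n m A := by
  refine mem_LinEq.2 ⟨funext fun i => ?_, fun h => ?_⟩
  · change A i ⬝ᵥ cramerVector A I J j₀ = 0
    refine Submodule.span_induction (p := fun v _ => v ⬝ᵥ cramerVector A I J j₀ = 0) ?_
      (zero_dotProduct _) (fun v w _ _ hv hw => by rw [add_dotProduct, hv, hw, add_zero])
      (fun c v _ hv => by rw [smul_dotProduct, hv, smul_zero])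
      (row_mem_span_of_minor_ne_zero hr hdet i)
    rintro _ ⟨k, rfl⟩
    have h := congrFun (Matrix.mulVec_cramer (A.submatrix I J) fun i => A (I i) j₀) k
    simp only [Matrix.mulVec, dotProduct, Matrix.submatrix_apply, Pi.smul_apply,
      smul_eq_mul] at h
    rw [dotProduct_cramerVector, h]
    ring
  · have h0 := congrFun h j₀
    simp [cramerVector, hj₀] at h0
    exact hdet h0

theorem approximable_cramerVector {n m r : ℕ} (I : Fin r → Fin n) (J : Fin r → Fin m)
    (j₀ j : Fin m) :
    Approximable (rhoMatrix n m) (n * m) fun A => cramerVector A I J j₀ j := by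
  have hz : Approximable (rhoMatrix n m) (n * m) fun _ => 0 := by
    simpa using Approximable.const (α := rhoMatrix n m) (N₀ := n * m) 0
  have hneg : Approximable (rhoMatrix n m) (n * m) fun _ => -1 := by
    simpa using Approximable.const (α := rhoMatrix n m) (N₀ := n * m) (-1)
  unfold cramerVector
  refine .add ?_ (hneg.mul (.sum _ fun k _ => ?_))
  · split_ifs
    · exact .det fun _ _ => .entry _ _
    · exact hz
  · split_ifs
    · exact .cramer (fun _ _ => .entry _ _) (fun _ => .entry _ _) k
    · exact hz

theorem isComputableKnowing_rank (n m d : ℕ) (hm : 1 ≤ m) (hd : d = min n (m - 1)) :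
    IsComputableKnowing (rhoMatrix n m) (rho.pow m) (LinEq n m) (fun A => A.rank) := by
  classical
  let C := Σ r : Fin (d + 1), (Fin r → Fin n) × (Fin r → Fin m) × Fin m
  let e : C ≃ Fin (Fintype.card C) := Fintype.equivFin C
  -- Squaring the minor turns nonvanishing into positivity; candidates with `j₀` among the columns
  -- `J` are disabled.
  let D : C → Matrix (Fin n) (Fin m) ℝ → ℝ := fun c A =>
    if ∀ k, c.2.2.2 ≠ c.2.2.1 k then
      (A.submatrix c.2.1 c.2.2.1).det * (A.submatrix c.2.1 c.2.2.1).det else 0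
  refine isComputableKnowing_of_approximable (N₀ := n * m) hm (fun c => ((e.symm c).1 : ℕ))
    (fun c => D (e.symm c)) (fun c A => cramerVector A (e.symm c).2.1 (e.symm c).2.2.1
      (e.symm c).2.2.2) (fun c => ?_) (fun c j => approximable_cramerVector _ _ _ _)
    (fun c A _ hr hpos => ?_) (fun A hA => ?_)
  · by_cases h : ∀ k, (e.symm c).2.2.2 ≠ (e.symm c).2.2.1 k
    · simp only [D, if_pos h]
      exact .mul (.det fun _ _ => .entry _ _) (.det fun _ _ => .entry _ _)
    · simp only [D, if_neg h]
      simpa using Approximable.const (α := rhoMatrix n m) (N₀ := n * m) 0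
  · simp only [D] at hpos
    split_ifs at hpos with h
    · exact cramerVector_mem_linEq hr (fun h0 => by simp [h0] at hpos) h
    · exact absurd hpos (lt_irrefl _)
  · rw [multiDom_linEq n m d hm hd, Set.mem_ofPred_eq] at hA
    obtain ⟨I, J, hdet⟩ := exists_minor_ne_zero (A := A) rfl
    obtain ⟨j₀, hj₀⟩ : ∃ j₀, ∀ k, j₀ ≠ J k := by
      by_contra! H
      have hs : Function.Surjective J := fun j => (H j).imp fun _ h => h.symm
      have := Fintype.card_le_of_surjective J hs
      simp only [Fintype.card_fin] at this
      omega
    refine ⟨e ⟨⟨A.rank, Nat.lt_succ_of_le hA⟩, I, J, j₀⟩, by simp, ?_⟩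
    simp only [Equiv.symm_apply_apply, D]
    rw [if_pos hj₀]
    exact mul_self_pos.2 hdet

/-! ### Rank strata and the two complexities. -/

/-- The set of matrices of rank `r`. -/
def rankStratum (n m r : ℕ) : Set (Matrix (Fin n) (Fin m) ℝ) := {A | A.rank = r}

theorem rankStratum_injective {n m d : ℕ} (hm : 1 ≤ m) (hd : d = min n (m - 1)) :
    Function.Injective fun r : Fin (d + 1) => rankStratum n m r := by
  intro r s h
  obtain ⟨A, hA⟩ := exists_rank_eq (n := n) (m := m) (k := r) (by omega) hm
  have h1 : A ∈ rankStratum n m s := (Set.ext_iff.1 h A).1 hA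
  exact Fin.ext (hA.symm.trans h1)

theorem mk_range_rankStratum {n m d : ℕ} (hm : 1 ≤ m) (hd : d = min n (m - 1)) :
    #(Set.range fun r : Fin (d + 1) => rankStratum n m r) = (d : Cardinal) + 1 := by
  rw [Cardinal.mk_range_eq _ (rankStratum_injective hm hd), Cardinal.mk_fin]
  push_cast
  rfl

theorem sUnion_range_rankStratum {n m d : ℕ} (hm : 1 ≤ m) (hd : d = min n (m - 1)) :
    ⋃₀ (Set.range fun r : Fin (d + 1) => rankStratum n m r) = MultiDom (LinEq n m) := by
  rw [multiDom_linEq n m d hm hd, Set.sUnion_range]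
  ext A
  simp only [Set.mem_iUnion, rankStratum, Set.mem_ofPred_eq]
  exact ⟨fun ⟨r, hr⟩ => hr ▸ Nat.lt_succ_iff.1 r.isLt,
    fun h => ⟨⟨A.rank, Nat.lt_succ_of_le h⟩, rfl⟩⟩

theorem rankStratum_subset_multiDom {n m d : ℕ} (hm : 1 ≤ m) (hd : d = min n (m - 1))
    (r : Fin (d + 1)) : rankStratum n m r ⊆ MultiDom (LinEq n m) := by
  rw [← sUnion_range_rankStratum hm hd]
  exact Set.subset_sUnion_of_mem ⟨r, rfl⟩

theorem isCardinalOfDiscontinuity_linEq (n m d : ℕ) (hm : 1 ≤ m) (hd : d = min n (m - 1)) :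
    IsCardinalOfDiscontinuity (LinEq n m) ((d : Cardinal) + 1) := by
  obtain ⟨M, hM⟩ := isComputableKnowing_rank n m d hm hd
  refine ⟨⟨_, sUnion_range_rankStratum hm hd, mk_range_rankStratum hm hd, ?_⟩, ?_⟩
  · rintro _ ⟨r, rfl⟩
    refine multiContinuousOn_of_machine M r fun A hA p hp => ?_
    have h := hM A (rankStratum_subset_multiDom hm hd r hA) p hp
    have hr : A.rank = r := hA
    simpa only [hr] using h
  · rintro k ⟨Δ, hΔ, rfl, hc⟩
    exact le_mk_of_multiContinuousOn_linEq hm hd hΔ hc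

theorem isNonuniformComplexity_linEq (n m d : ℕ) (hm : 1 ≤ m) (hd : d = min n (m - 1)) :
    IsNonuniformComplexity (rhoMatrix n m) (rho.pow m) (LinEq n m) ((d : Cardinal) + 1) := by
  obtain ⟨M, hM⟩ := isComputableKnowing_rank n m d hm hd
  have hrank : ∀ {A : Matrix (Fin n) (Fin m) ℝ} {r : ℕ}, A ∈ rankStratum n m r → A.rank = r :=
    fun h => h
  refine ⟨⟨Set.range fun r : Fin (d + 1) => rankStratum n m r, ?_, ?_,
    sUnion_range_rankStratum hm hd, Set.countable_range _, mk_range_rankStratum hm hd,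
    ⟨fun w S => ∃ r : Fin (d + 1), (r : ℕ) = w ∧ (S : Set _) = rankStratum n m r, ?_, ?_⟩,
    M, ?_⟩, ?_⟩
  · rintro ⟨r, hr⟩
    obtain ⟨A, hA⟩ := exists_rank_eq (n := n) (m := m) (k := r) (by omega) hm
    have h : A ∈ rankStratum n m r := hA
    rw [show rankStratum n m r = ∅ from hr] at h
    exact h
  · rintro _ ⟨r, rfl⟩ _ ⟨s, rfl⟩ hne
    refine Set.disjoint_left.2 fun A hA hA' => hne ?_
    have h : (r : ℕ) = s := (hrank hA).symm.trans (hrank hA')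
    rw [Fin.ext h]
  · rintro w S S' ⟨r, hr, hS⟩ ⟨s, hs, hS'⟩
    exact Subtype.ext (by rw [hS, hS', hr, hs])
  · rintro ⟨_, r, rfl⟩
    exact ⟨r, r, rfl, rfl⟩
  · rintro S A hA p hp w ⟨r, rfl, hS⟩
    rw [hS] at hA
    have h := hM A (rankStratum_subset_multiDom hm hd r hA) p hp
    simpa only [hrank hA] using h
  -- With one name of a member fixed as advice, the machine shows continuity on that member, so the
  -- bound for covers applies.
  · rintro k ⟨Δ, -, -, hΔ, -, rfl, δ, M', hM'⟩
    refine le_mk_of_multiContinuousOn_linEq hm hd hΔ fun S hS => ?_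
    obtain ⟨w, hw⟩ := δ.surjective ⟨S, hS⟩
    exact multiContinuousOn_of_machine M' w fun A hA p hp => hM' ⟨S, hS⟩ A hA p hp w hw

theorem theorem3p1 (n m d : ℕ) (hm : 1 ≤ m) (hd : d = min n (m - 1)) :
    MultiDom (LinEq n m) = {A : Matrix (Fin n) (Fin m) ℝ | A.rank ≤ d} ∧
    IsCardinalOfDiscontinuity (LinEq n m) ((d : Cardinal) + 1) ∧
    IsNonuniformComplexity (rhoMatrix n m) (rho.pow m) (LinEq n m) ((d : Cardinal) + 1) ∧
    IsComputableKnowing (rhoMatrix n m) (rho.pow m) (LinEq n m) (fun A => A.rank) ∧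
    ∃ x : List ℕ → Matrix (Fin n) (Fin m) ℝ, IsKDiscontinuityWitness (LinEq n m) d x :=
  ⟨multiDom_linEq n m d hm hd, isCardinalOfDiscontinuity_linEq n m d hm hd,
    isNonuniformComplexity_linEq n m d hm hd, isComputableKnowing_rank n m d hm hd,
    basisFlag n m hm, isKDiscontinuityWitness_basisFlag n m d hm hd⟩
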